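/- Let $W_i^{(j)}$, $i,j\in\mathbb N=\{1,2,\dots\}$, be independent standard Brownian motions on $\mathbb R$ (two-sided, $W_i^{(j)}(0)=0$). Let $X_i^{(j)}$, $i,j\in\mathbb N$, be real random variables such that the point processes $\sum_{i\in\mathbb N}\delta_{X_i^{(j)}}$, $j\in\mathbb N$, are independent Poisson point processes on $\mathbb R$ with intensity measure $e^{-x}\,dx$, and such that the family $(X_i^{(j)})_{i,j\in\mathbb N}$ is independent of the family $(W_i^{(j)})_{i,j\in\mathbb N}$. Let $h>0$ and let $0<a_1<a_2<a_3<\dots$ be equidistant points with spacing $h$, i.e. $a_{j+1}=a_j+h$, with $a_1>4+h$ and $a_1\in h\mathbb Z$. Let $L>0$ with $L\in h\mathbb Z$, and let $C\in\mathbb R$. Then, with $x\vee y=\max\{x,y\}$, $$ \begin{aligned} &\mathbb P\Big(\exists\, i,j\in\mathbb N:\ C< X_i^{(j)}+\sup_{t\in[a_j,a_j+L]\cap h\mathbb Z}\Big(W_i^{(j)}(t)-\frac t2\Big)\le X_i^{(j)}+W_i^{(j)}(0)\Big)\\ &\le \frac{8e^{-C}}{h}\Bigg(\exp\Big(-\frac{\sqrt{a_1-h}}{2}\Big)\\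 &\qquad+\frac{25L}{9}\sqrt{\frac{2L}{\pi}}\,\exp\Bigg(-\frac{\Big(\frac3{10}\sqrt{a_1-h}+\frac15\sqrt{(a_1-h)\vee 25}-\log\Big(\frac{\sqrt{(a_1-h)\vee 25}}{2}\Big)\Big)^2}{2L}\Bigg)\\ &\qquad+\frac1{\sqrt{2\pi}}\Big(1+\frac1{\sqrt{a_1-h}-2}\Big)\exp\Big(-\frac{(\sqrt{a_1-h}-2)^2}{8}\Big)\Bigg). \end{aligned} $$ -/

import Mathlib

open MeasureTheory ProbabilityTheory
open scoped ENNReal NNReal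

/-- A standard Brownian motion on the whole real line: a real-valued process indexed by `ℝ` whose
two halves `t ↦ B t` and `t ↦ B (-t)`, for `t ≥ 0`, are independent standard Brownian motions
started at `0` (with almost surely continuous paths). -/
structure IsTwoSidedBrownianReal {Ω : Type*} [MeasurableSpace Ω]
    (B : ℝ → Ω → ℝ) (P : Measure Ω) : Prop where
  measurable : ∀ t : ℝ, Measurable (B t)
  forward : IsBrownianReal (fun (t : ℝ≥0) ω => B (t : ℝ) ω) P
  backward : IsBrownianReal (fun (t : ℝ≥0) ω => B (-(t : ℝ)) ω) P
  indep : IndepFun (fun ω (t : ℝ≥0) => B (t : ℝ) ω) (fun ω (t : ℝ≥0) => B (-(t : ℝ)) ω) P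

/-- The Poisson distribution with parameter `r ∈ [0, ∞]`, as a law on `[0, ∞]`; for `r = ∞` it is
the point mass at `∞`. -/
noncomputable def extPoissonMeasure (r : ℝ≥0∞) : Measure ℝ≥0∞ :=
  open Classical in
  if r = ∞ then Measure.dirac ∞
  else (poissonMeasure r.toNNReal).map (fun n : ℕ => (n : ℝ≥0∞))

/-- `N` is a Poisson point process with intensity measure `μ`: a random counting measure such that
the numbers of points in pairwise disjoint measurable sets are independent, and the number of points
in a measurable set `A` is Poisson distributed with parameter `μ A`. -/
structure IsPoissonPointProcess {Ω S : Type*} [MeasurableSpace Ω] [MeasurableSpace S]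
    (N : Ω → Measure S) (μ : Measure S) (P : Measure Ω) : Prop where
  measurable : Measurable N
  counting : ∀ ω, ∀ A : Set S, MeasurableSet A → ∃ n : ℕ∞, N ω A = (n : ℝ≥0∞)
  indep : ∀ (n : ℕ) (A : Fin n → Set S), (∀ k, MeasurableSet (A k)) →
    Pairwise (fun k l => Disjoint (A k) (A l)) → iIndepFun (fun k ω => N ω (A k)) P
  poisson : ∀ A : Set S, MeasurableSet A →
    HasLaw (fun ω => N ω A) (extPoissonMeasure (μ A)) P

/-- The random point measure `∑ i, δ_{X i}` of a sequence of random points. -/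
noncomputable def pointMeasure {Ω S : Type*} [MeasurableSpace S] (X : ℕ → Ω → S) (ω : Ω) :
    Measure S :=
  Measure.sum (fun i => Measure.dirac (X i ω))

/-- The measure `e^{-x} dx` on the real line. -/
noncomputable def expNegMeasure : Measure ℝ :=
  volume.withDensity (fun x => ENNReal.ofReal (Real.exp (-x)))

/-- The maximum of `w t - t / 2` over the times `t ∈ [a, a + L] ∩ hℤ`. -/
noncomputable def driftedLatticeSup (h L a : ℝ) (w : ℝ → ℝ) : ℝ :=
  sSup ((fun t => w t - t / 2) '' (Set.Icc a (a + L) ∩ (AddSubgroup.zmultiples h : Set ℝ)))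

/-! A union bound over `j` and `i` suffices. Let `M` be the drifted maximum over the window starting
at `a j`. Since `W 0 = 0` almost surely, the event for `(i, j)` says `C < X + M` and `M ≤ 0`.
Summing over `i` with the intensity `e^{-x} dx` gives exactly `e^{-C} E[e^M; M ≤ 0]`
(`tsum_measure_displaced_eq`).

Write `M = (W a - a/2) + S`, where `S` is the maximum of the path restarted at `a`, independent of
`W a`. Integrating out the Gaussian `W a` costs `e^{-a/8} / √a` up to a constant and leaves
`e^{S/2}` (`lintegral_gaussianReal_expNonpos_le`). A supermartingale shows `E e^{S/2} ≤ 2` whatever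
the window length (`lintegral_maxPotential_le`), so `L` drops out.

The resulting terms decay geometrically in `j`; their sum is dominated by the last of the three
terms in the claim alone (`four_mul_exp_div_sqrt_le`). -/

/-! ### Exponential moment of the drifted running maximum. -/

/-- The path `w` with drift `-1/2`, sampled at the multiples of `h`. -/
noncomputable def driftedSample (h : ℝ≥0) (w : ℝ≥0 → ℝ) (k : ℕ) : ℝ :=
  w (k * h) - k * h / 2

/-- The running maximum of the sampled drifted path over the first `n + 1` multiples of `h`. -/
noncomputable def driftedSampleMax (h : ℝ≥0) (w : ℝ≥0 → ℝ) (n : ℕ) : ℝ :=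
  partialSups (driftedSample h w) n

lemma driftedSampleMax_succ (h : ℝ≥0) (w : ℝ≥0 → ℝ) (n : ℕ) :
    driftedSampleMax h w (n + 1) = max (driftedSampleMax h w n) (driftedSample h w (n + 1)) :=
  partialSups_add_one _ _

lemma measurable_driftedSample (h : ℝ≥0) (k : ℕ) : Measurable (fun w => driftedSample h w k) := by
  unfold driftedSample; fun_prop

lemma measurable_driftedSampleMax (h : ℝ≥0) (n : ℕ) :
    Measurable (fun w => driftedSampleMax h w n) := by
  induction n with
  | zero => simpa [driftedSampleMax] using measurable_driftedSample h 0
  | succ n ih =>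
    simp_rw [driftedSampleMax_succ]
    exact ih.max (measurable_driftedSample h _)

/-- The potential `e^{m/2} + e^{r - m/2}` of a drifted path at level `r` with running maximum `m`. -/
noncomputable def maxPotential (h : ℝ≥0) (n : ℕ) (w : ℝ≥0 → ℝ) : ℝ :=
  Real.exp (driftedSampleMax h w n / 2) +
    Real.exp (driftedSample h w n - driftedSampleMax h w n / 2)

lemma driftedSample_succ (h : ℝ≥0) (w : ℝ≥0 → ℝ) (n : ℕ) :
    driftedSample h w (n + 1) = driftedSample h w n + (w (n * h + h) - w (n * h) - h / 2) := by
  have : ((n + 1 : ℕ) : ℝ≥0) * h = n * h + h := by push_cast; ring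
  simp only [driftedSample, this]
  push_cast
  ring

/-- Updating the maximum never raises the potential: when `r > m` the new value is `2 e^{r/2}`,
twice the geometric mean of the two summands on the right. -/
lemma exp_half_max_add_le (m r : ℝ) :
    Real.exp (max m r / 2) + Real.exp (r - max m r / 2) ≤
      Real.exp (m / 2) + Real.exp (r - m / 2) := by
  rcases le_total r m with hr | hr
  · simp [hr]
  · rw [max_eq_right hr]
    have h1 : Real.exp (m / 2) = Real.exp (m / 4) ^ 2 := by
      rw [← Real.exp_nat_mul]; ring_nf
    have h2 : Real.exp (r - m / 2) = Real.exp (r / 2 - m / 4) ^ 2 := by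
      rw [← Real.exp_nat_mul]; ring_nf
    have h3 : Real.exp (r / 2) = Real.exp (m / 4) * Real.exp (r / 2 - m / 4) := by
      rw [← Real.exp_add]; ring_nf
    have h4 : r - r / 2 = r / 2 := by ring
    rw [h4, h1, h2, h3]
    nlinarith [sq_nonneg (Real.exp (m / 4) - Real.exp (r / 2 - m / 4))]

lemma maxPotential_succ_le (h : ℝ≥0) (n : ℕ) (w : ℝ≥0 → ℝ) :
    maxPotential h (n + 1) w ≤ Real.exp (driftedSampleMax h w n / 2) +
      Real.exp (driftedSample h w n - driftedSampleMax h w n / 2) *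
        Real.exp (w (n * h + h) - w (n * h) - h / 2) := by
  rw [maxPotential, driftedSampleMax_succ]
  refine (exp_half_max_add_le _ _).trans_eq ?_
  rw [← Real.exp_add, driftedSample_succ]
  ring_nf

section Brownian

variable {Ω : Type*} {mΩ : MeasurableSpace Ω} {P : Measure Ω}

lemma ProbabilityTheory.HasLaw.lintegral_exp_sub_half_eq_one {Z : Ω → ℝ} {v : ℝ≥0}
    (hZ : HasLaw Z (gaussianReal 0 v) P) :
    ∫⁻ ω, ENNReal.ofReal (Real.exp (Z ω - v / 2)) ∂P = 1 := by
  have h1 : ∫⁻ ω, ENNReal.ofReal (Real.exp (Z ω - v / 2)) ∂P =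
      ∫⁻ x, ENNReal.ofReal (Real.exp (x - v / 2)) ∂(gaussianReal 0 v) := by
    rw [← hZ.map_eq, lintegral_map' (by fun_prop) hZ.aemeasurable]
  have hint : Integrable (fun x => Real.exp (x - v / 2)) (gaussianReal 0 v) := by
    simp_rw [Real.exp_sub]
    simpa using (integrable_exp_mul_gaussianReal (μ := 0) (v := v) 1).div_const _
  rw [h1, ← ofReal_integral_eq_lintegral_ofReal hint (ae_of_all _ fun _ => (Real.exp_pos _).le)]
  have h2 := congrFun (mgf_fun_id_gaussianReal (μ := 0) (v := v)) 1
  simp only [mgf, one_mul] at h2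
  simp_rw [Real.exp_sub, integral_div, h2, ← Real.exp_sub]
  simp

/-- The path up to time `t` is independent of the increment after time `t`. -/
lemma ProbabilityTheory.IsPreBrownianReal.indepFun_increment {B : ℝ≥0 → Ω → ℝ}
    (hB : IsPreBrownianReal B P) (t s : ℝ≥0) :
    IndepFun (fun ω (u : Set.Iic t) => B u ω) (fun ω => B (t + s) ω - B t ω) P :=
  ((hB.indepFun_shift t).comp (measurable_pi_apply s) measurable_id).symm

lemma driftedSample_congr {h : ℝ≥0} {w w' : ℝ≥0 → ℝ} {k n : ℕ} (hk : k ≤ n)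
    (hw : ∀ u ≤ n * h, w u = w' u) : driftedSample h w k = driftedSample h w' k := by
  rw [driftedSample, driftedSample, hw]
  gcongr

lemma driftedSampleMax_congr {h : ℝ≥0} {w w' : ℝ≥0 → ℝ} {n : ℕ}
    (hw : ∀ u ≤ n * h, w u = w' u) : driftedSampleMax h w n = driftedSampleMax h w' n := by
  rw [driftedSampleMax, driftedSampleMax, partialSups_eq_sup'_range, partialSups_eq_sup'_range]
  refine Finset.sup'_congr _ rfl fun k hk => driftedSample_congr ?_ hw
  exact Nat.lt_succ_iff.1 (Finset.mem_range.1 hk)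

/-- The potential is a supermartingale started at `2`. With the maximum frozen, a step multiplies
only the second summand, by an independent factor of mean `1`; updating the maximum can then only
lower the value. -/
lemma lintegral_maxPotential_le {B : ℝ≥0 → Ω → ℝ} (hB : IsPreBrownianReal B P)
    (hm : ∀ t, Measurable (B t)) (h : ℝ≥0) (n : ℕ) :
    ∫⁻ ω, ENNReal.ofReal (maxPotential h n (B · ω)) ∂P ≤ 2 := by
  have := hB.isGaussianProcess.isProbabilityMeasure
  have hBm : Measurable (fun ω t => B t ω) := by fun_prop
  induction n with
  | zero =>
    have : ∀ᵐ ω ∂P, ENNReal.ofReal (maxPotential h 0 (B · ω)) = 2 := by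
      filter_upwards [hB.eval_zero_ae_eq_zero] with ω hω
      simp [maxPotential, driftedSampleMax, driftedSample, hω, one_add_one_eq_two]
    simp [lintegral_congr_ae this]
  | succ n ih =>
    have hmax : Measurable (fun ω => driftedSampleMax h (B · ω) n) :=
      (measurable_driftedSampleMax h n).comp hBm
    have hsam : Measurable (fun ω => driftedSample h (B · ω) n) :=
      (measurable_driftedSample h n).comp hBm
    have hind : IndepFun
        (fun ω => ENNReal.ofReal
          (Real.exp (driftedSample h (B · ω) n - driftedSampleMax h (B · ω) n / 2)))
        (fun ω => ENNReal.ofReal (Real.exp (B (n * h + h) ω - B (n * h) ω - h / 2))) P := by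
      -- Independence concerns the path restricted to `[0, n h]`. Extending it by zero changes
      -- neither the sample nor the maximum at step `n`, which read no later times.
      let ext (p : Set.Iic (n * h) → ℝ) (t : ℝ≥0) : ℝ :=
        if ht : t ≤ n * h then p ⟨t, ht⟩ else 0
      have hext : Measurable ext := by
        refine measurable_pi_lambda _ fun t => ?_
        by_cases ht : t ≤ n * h
        · simpa [ext, ht] using measurable_pi_apply _
        · simp [ext, ht]
      have key := (hB.indepFun_increment (n * h) h).comp
        (φ := fun p => ENNReal.ofReal
          (Real.exp (driftedSample h (ext p) n - driftedSampleMax h (ext p) n / 2)))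
        (ψ := fun x => ENNReal.ofReal (Real.exp (x - h / 2)))
        (by
          have h1 := (measurable_driftedSampleMax h n).comp hext
          have h2 := (measurable_driftedSample h n).comp hext
          exact (Real.measurable_exp.comp (h2.sub (h1.div_const 2))).ennreal_ofReal)
        (by fun_prop)
      refine key.congr (ae_of_all _ fun ω => ?_) .rfl
      have hw : ∀ u ≤ n * h, B u ω = ext (fun u => B u ω) u := fun u hu => by simp [ext, hu]
      simp only [Function.comp_apply]
      rw [driftedSample_congr le_rfl hw, driftedSampleMax_congr hw]
    have hone : ∫⁻ ω, ENNReal.ofReal (Real.exp (B (n * h + h) ω - B (n * h) ω - h / 2)) ∂P = 1 := by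
      refine HasLaw.lintegral_exp_sub_half_eq_one (v := h)
        (Z := fun ω => B (n * h + h) ω - B (n * h) ω) ?_
      exact (hB.shift (n * h)).hasLaw_eval h
    calc ∫⁻ ω, ENNReal.ofReal (maxPotential h (n + 1) (B · ω)) ∂P
        ≤ ∫⁻ ω, (ENNReal.ofReal (Real.exp (driftedSampleMax h (B · ω) n / 2)) +
            ENNReal.ofReal
              (Real.exp (driftedSample h (B · ω) n - driftedSampleMax h (B · ω) n / 2)) *
            ENNReal.ofReal (Real.exp (B (n * h + h) ω - B (n * h) ω - h / 2))) ∂P := by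
          refine lintegral_mono fun ω => ?_
          rw [← ENNReal.ofReal_mul (Real.exp_pos _).le, ← ENNReal.ofReal_add (by positivity)
            (by positivity)]
          exact ENNReal.ofReal_le_ofReal (maxPotential_succ_le h n _)
      _ = ∫⁻ ω, ENNReal.ofReal (maxPotential h n (B · ω)) ∂P := by
          rw [lintegral_add_left (by fun_prop),
            lintegral_mul_eq_lintegral_mul_lintegral_of_indepFun'' (by fun_prop) (by fun_prop) hind,
            hone, mul_one, ← lintegral_add_left (by fun_prop)]
          refine lintegral_congr fun ω => ?_
          rw [← ENNReal.ofReal_add (by positivity) (by positivity), maxPotential]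
      _ ≤ 2 := ih

/-- The exponential moment of order `1/2` of the maximum of a Brownian motion with drift `-1/2`
is at most `2`. -/
lemma lintegral_exp_half_driftedSampleMax_le {B : ℝ≥0 → Ω → ℝ} (hB : IsPreBrownianReal B P)
    (hm : ∀ t, Measurable (B t)) (h : ℝ≥0) (n : ℕ) :
    ∫⁻ ω, ENNReal.ofReal (Real.exp (driftedSampleMax h (B · ω) n / 2)) ∂P ≤ 2 :=
  (lintegral_mono fun _ => ENNReal.ofReal_le_ofReal
    (le_add_of_nonneg_right (Real.exp_pos _).le)).trans (lintegral_maxPotential_le hB hm h n)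

end Brownian

/-! ### Gaussian integration and the lattice maximum. -/

/-- The function `e^m 1_{m ≤ 0}`. -/
noncomputable def expNonpos (m : ℝ) : ℝ≥0∞ :=
  (Set.Iic 0).indicator (fun m => ENNReal.ofReal (Real.exp m)) m

lemma measurable_expNonpos : Measurable expNonpos :=
  Measurable.indicator (by fun_prop) measurableSet_Iic

/-- The Gaussian exponent `-y²/(2v)` lies below its tangent at `y = v/2`, the threshold for `s = 0`.
The remaining `e^{y/2}` integrates explicitly over a left half-line. -/
lemma gaussianPDFReal_mul_exp_le {v : ℝ≥0} (hv : v ≠ 0) (y s : ℝ) :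
    gaussianPDFReal 0 v y * Real.exp (y - v / 2 + s) ≤
      Real.exp (s - 3 * v / 8) / √(2 * Real.pi * v) * Real.exp (1 / 2 * y) := by
  have hv' : (0 : ℝ) < v := by positivity
  have h1 : (0 : ℝ) ≤ (y - v / 2) ^ 2 / (2 * v) := by positivity
  have h2 : (y - v / 2) ^ 2 / (2 * v) = -(-(y - 0) ^ 2 / (2 * v)) - y / 2 + v / 8 := by
    field_simp; ring
  calc gaussianPDFReal 0 v y * Real.exp (y - v / 2 + s)
      = (√(2 * Real.pi * v))⁻¹ * Real.exp (-(y - 0) ^ 2 / (2 * v) + (y - v / 2 + s)) := by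
        rw [gaussianPDFReal, mul_assoc, ← Real.exp_add]
    _ ≤ (√(2 * Real.pi * v))⁻¹ * Real.exp (s - 3 * v / 8 + 1 / 2 * y) :=
        mul_le_mul_of_nonneg_left (Real.exp_le_exp.2 (by linarith)) (by positivity)
    _ = _ := by
        rw [Real.exp_add]
        ring

lemma lintegral_gaussianReal_expNonpos_le {v : ℝ≥0} (hv : v ≠ 0) (s : ℝ) :
    ∫⁻ y, expNonpos (y - v / 2 + s) ∂(gaussianReal 0 v) ≤
      ENNReal.ofReal (2 * Real.exp (-(v / 8)) / √(2 * Real.pi * v)) *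
        ENNReal.ofReal (Real.exp (s / 2)) := by
  set c : ℝ := Real.exp (s - 3 * v / 8) / √(2 * Real.pi * v) with hc
  have hc0 : 0 ≤ c := by positivity
  rw [gaussianReal_of_var_ne_zero _ hv, lintegral_withDensity_eq_lintegral_mul _
    (measurable_gaussianPDF 0 v) (f := gaussianPDF 0 v)
    (g := fun y => expNonpos (y - v / 2 + s))
    (measurable_expNonpos.comp (by fun_prop : Measurable fun y : ℝ => y - v / 2 + s))]
  calc ∫⁻ y, (gaussianPDF 0 v * fun y => expNonpos (y - v / 2 + s)) y
      ≤ ∫⁻ y, (Set.Iic (v / 2 - s)).indicator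
          (fun y => ENNReal.ofReal (c * Real.exp (1 / 2 * y))) y := by
        refine lintegral_mono fun y => ?_
        simp only [Pi.mul_apply, expNonpos, Set.indicator, Set.mem_Iic]
        by_cases hy : y - v / 2 + s ≤ 0
        · rw [if_pos hy, if_pos (by linarith), gaussianPDF,
            ← ENNReal.ofReal_mul (gaussianPDFReal_nonneg _ _ _)]
          exact ENNReal.ofReal_le_ofReal (gaussianPDFReal_mul_exp_le hv y s)
        · simp [hy]
    _ = ENNReal.ofReal (c * (Real.exp (1 / 2 * (v / 2 - s)) / (1 / 2))) := by
        rw [lintegral_indicator measurableSet_Iic,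
          ← ofReal_integral_eq_lintegral_ofReal
            ((integrableOn_exp_mul_Iic (by norm_num) _).const_mul c)
            (ae_of_all _ fun _ => by positivity), integral_const_mul,
          integral_exp_mul_Iic (by norm_num)]
    _ = _ := by
        rw [← ENNReal.ofReal_mul (by positivity)]
        congr 1
        have : Real.exp (s - 3 * v / 8) * Real.exp (1 / 2 * (v / 2 - s)) =
            Real.exp (-(v / 8)) * Real.exp (s / 2) := by
          rw [← Real.exp_add, ← Real.exp_add]; ring_nf
        rw [hc, div_div_eq_mul_div, div_one, div_mul_eq_mul_div, ← mul_assoc, this]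
        ring

section Brownian

variable {Ω : Type*} {mΩ : MeasurableSpace Ω} {P : Measure Ω}

/-- The maximum of `w t - t / 2` over the times `a, a + h, …, a + n h`. -/
noncomputable def latticeMax (h a : ℝ≥0) (n : ℕ) (w : ℝ≥0 → ℝ) : ℝ :=
  w a - a / 2 + driftedSampleMax h (fun t => w (a + t) - w a) n

lemma measurable_latticeMax (h a : ℝ≥0) (n : ℕ) : Measurable (latticeMax h a n) := by
  refine Measurable.add (by fun_prop) ((measurable_driftedSampleMax h n).comp ?_)
  fun_prop

lemma lintegral_expNonpos_latticeMax_le {B : ℝ≥0 → Ω → ℝ} (hB : IsPreBrownianReal B P)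
    (hm : ∀ t, Measurable (B t)) (h : ℝ≥0) {a : ℝ≥0} (ha : a ≠ 0) (n : ℕ) :
    ∫⁻ ω, expNonpos (latticeMax h a n (B · ω)) ∂P ≤
      ENNReal.ofReal (4 * Real.exp (-(a / 8)) / √(2 * Real.pi * a)) := by
  have := hB.isGaussianProcess.isProbabilityMeasure
  set S : Ω → ℝ := fun ω => driftedSampleMax h (fun t => B (a + t) ω - B a ω) n with hS
  have hSm : Measurable S := (measurable_driftedSampleMax h n).comp (by fun_prop)
  have hind : IndepFun S (B a) P :=
    (hB.indepFun_shift a).comp (measurable_driftedSampleMax h n)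
      (measurable_pi_apply (⟨a, Set.mem_Iic.2 le_rfl⟩ : Set.Iic a))
  have hF : Measurable (fun p : ℝ × ℝ => expNonpos (p.2 - a / 2 + p.1)) :=
    measurable_expNonpos.comp (by fun_prop)
  calc ∫⁻ ω, expNonpos (latticeMax h a n (B · ω)) ∂P
      = ∫⁻ p, expNonpos (p.2 - a / 2 + p.1) ∂((P.map S).prod (P.map (B a))) := by
        rw [← (indepFun_iff_map_prod_eq_prod_map_map hSm.aemeasurable (hm a).aemeasurable).1 hind,
          lintegral_map hF (hSm.prodMk (hm a))]
        rfl
    _ = ∫⁻ s, ∫⁻ y, expNonpos (y - a / 2 + s) ∂(gaussianReal 0 a) ∂(P.map S) := by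
        rw [lintegral_prod _ hF.aemeasurable, (hB.hasLaw_eval a).map_eq]
    _ ≤ ∫⁻ s, ENNReal.ofReal (2 * Real.exp (-(a / 8)) / √(2 * Real.pi * a)) *
          ENNReal.ofReal (Real.exp (s / 2)) ∂(P.map S) :=
        lintegral_mono fun s => lintegral_gaussianReal_expNonpos_le ha s
    _ = ENNReal.ofReal (2 * Real.exp (-(a / 8)) / √(2 * Real.pi * a)) *
          ∫⁻ ω, ENNReal.ofReal (Real.exp (S ω / 2)) ∂P := by
        rw [lintegral_const_mul _ (by fun_prop), lintegral_map (by fun_prop) hSm]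
    _ ≤ ENNReal.ofReal (2 * Real.exp (-(a / 8)) / √(2 * Real.pi * a)) * 2 := by
        gcongr
        exact lintegral_exp_half_driftedSampleMax_le (hB.shift a) (by fun_prop) h n
    _ = _ := by
        rw [← ENNReal.ofReal_ofNat 2, ← ENNReal.ofReal_mul (by positivity)]
        ring_nf

/-- The law of the lattice maximum is the same for all Brownian motions. -/
lemma map_latticeMax_eq {B B' : ℝ≥0 → Ω → ℝ} (hB : IsPreBrownianReal B P)
    (hB' : IsPreBrownianReal B' P) (hm : ∀ t, Measurable (B t)) (hm' : ∀ t, Measurable (B' t))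
    (h a : ℝ≥0) (n : ℕ) :
    P.map (fun ω => latticeMax h a n (B · ω)) = P.map (fun ω => latticeMax h a n (B' · ω)) := by
  have := hB.isGaussianProcess.isProbabilityMeasure
  have hBm : Measurable (fun ω t => B t ω) := by fun_prop
  have hBm' : Measurable (fun ω t => B' t ω) := by fun_prop
  have key : P.map (fun ω => (B · ω)) = P.map (fun ω => (B' · ω)) :=
    (map_eq_iff_forall_finset_map_restrict_eq hBm.aemeasurable hBm'.aemeasurable).2
      -- Finite-dimensional laws determine the law on the product σ-algebra, for which `latticeMax`
      -- is measurable; path continuity plays no role.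
      fun I => (hB.hasLaw I).map_eq.trans (hB'.hasLaw I).map_eq.symm
  have h1 := Measure.map_map (μ := P) (measurable_latticeMax h a n) hBm
  have h2 := Measure.map_map (μ := P) (measurable_latticeMax h a n) hBm'
  rw [key] at h1
  exact h1.symm.trans h2

end Brownian

/-! ### Identification of the supremum with a finite maximum. -/

lemma driftedLatticeSup_eq_latticeMax (h : ℝ≥0) (hh : 0 < h) (k n : ℕ) (w : ℝ → ℝ) :
    driftedLatticeSup h (n * h) (k * h) w =
      latticeMax h (k * h) n (fun t => w (t : ℝ)) := by
  have hh' : (0 : ℝ) < h := hh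
  have hval : ∀ i : ℕ, w (k * h) - k * h / 2 +
      driftedSample h (fun t => w ((k * h + t : ℝ≥0) : ℝ) - w ((k * h : ℝ≥0) : ℝ)) i =
      w ((k + i : ℕ) * h) - ((k + i : ℕ) * h : ℝ) / 2 := by
    intro i
    simp only [driftedSample]
    push_cast
    ring_nf
  have hmem : ∀ t : ℝ, t ∈ Set.Icc (k * h : ℝ) (k * h + n * h) ∩
      (AddSubgroup.zmultiples (h : ℝ) : Set ℝ) ↔ ∃ i : ℕ, i ≤ n ∧ t = (k + i : ℕ) * h := by
    intro t
    constructor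
    · rintro ⟨⟨h1, h2⟩, ht⟩
      obtain ⟨z, rfl⟩ := AddSubgroup.mem_zmultiples_iff.1 ht
      rw [zsmul_eq_mul] at h1 h2 ⊢
      rw [← add_mul] at h2
      have h1' : (k : ℝ) ≤ z := le_of_mul_le_mul_right h1 hh'
      have h2' : (z : ℝ) ≤ k + n := le_of_mul_le_mul_right h2 hh'
      have h1'' : (k : ℤ) ≤ z := by exact_mod_cast h1'
      have h2'' : z ≤ k + n := by exact_mod_cast h2'
      refine ⟨(z - k).toNat, by omega, ?_⟩
      congr 1
      have : z = ((k + (z - k).toNat : ℕ) : ℤ) := by omega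
      exact_mod_cast congrArg (Int.cast (R := ℝ)) this
    · rintro ⟨i, hi, rfl⟩
      have hi' : (i : ℝ) ≤ n := by exact_mod_cast hi
      refine ⟨⟨?_, ?_⟩, AddSubgroup.mem_zmultiples_iff.2 ⟨(k + i : ℕ), by simp⟩⟩
      · push_cast; nlinarith [Nat.cast_nonneg (α := ℝ) i]
      · push_cast; nlinarith
  refine IsGreatest.csSup_eq ⟨?_, ?_⟩
  · obtain ⟨i, hi, hi'⟩ := Finset.exists_mem_eq_sup' (Finset.nonempty_range_add_one (n := n))
      (driftedSample h (fun t => w ((k * h + t : ℝ≥0) : ℝ) - w ((k * h : ℝ≥0) : ℝ)))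
    refine ⟨(k + i : ℕ) * h, (hmem _).2 ⟨i, Nat.lt_succ_iff.1 (Finset.mem_range.1 hi), rfl⟩, ?_⟩
    rw [latticeMax, driftedSampleMax, partialSups_eq_sup'_range, hi']
    exact (hval i).symm
  · rintro _ ⟨t, ht, rfl⟩
    obtain ⟨i, hi, rfl⟩ := (hmem t).1 ht
    have := le_partialSups_of_le
      (driftedSample h (fun t => w ((k * h + t : ℝ≥0) : ℝ) - w ((k * h : ℝ≥0) : ℝ))) hi
    have h3 := hval i
    simp only at *
    rw [← h3, latticeMax, driftedSampleMax]
    push_cast at this ⊢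
    linarith

/-! ### Poisson means and displaced points. -/

lemma lintegral_cast_poissonMeasure (r : ℝ≥0) :
    ∫⁻ n, (n : ℝ≥0∞) ∂(poissonMeasure r) = r := by
  have hterm : ∀ n : ℕ, 0 ≤ Real.exp (-r) * r ^ n / (n.factorial : ℝ) := fun n => by positivity
  rw [poissonMeasure, lintegral_sum_measure]
  simp only [lintegral_smul_measure, lintegral_dirac, smul_eq_mul]
  rw [tsum_eq_zero_add' ENNReal.summable]
  have hsucc : ∀ n : ℕ, ENNReal.ofReal
      (Real.exp (-r) * r ^ (n + 1) / ((n + 1).factorial : ℝ)) * ((n + 1 : ℕ) : ℝ≥0∞) =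
      r * ENNReal.ofReal (Real.exp (-r) * r ^ n / (n.factorial : ℝ)) := by
    intro n
    rw [← ENNReal.ofReal_natCast (n + 1), ← ENNReal.ofReal_mul (by positivity),
      ← ENNReal.ofReal_coe_nnreal, ← ENNReal.ofReal_mul r.coe_nonneg]
    congr 1
    rw [Nat.factorial_succ]
    push_cast
    field_simp
    ring
  simp only [hsucc, Nat.cast_zero, mul_zero, zero_add]
  rw [ENNReal.tsum_mul_left, ← ENNReal.ofReal_tsum_of_nonneg hterm
    (hasSum_one_poissonMeasure r).summable, (hasSum_one_poissonMeasure r).tsum_eq]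
  simp

/-- The mean of the extended Poisson distribution is its parameter. -/
lemma lintegral_extPoissonMeasure (r : ℝ≥0∞) : ∫⁻ x, x ∂(extPoissonMeasure r) = r := by
  unfold extPoissonMeasure
  split_ifs with hr
  · simp [hr]
  · rw [lintegral_map (f := fun x => x) measurable_id (by fun_prop)]
    simpa [ENNReal.coe_toNNReal hr] using lintegral_cast_poissonMeasure r.toNNReal

lemma expNegMeasure_Ioi (c : ℝ) : expNegMeasure (Set.Ioi c) = ENNReal.ofReal (Real.exp (-c)) := by
  rw [expNegMeasure, withDensity_apply _ measurableSet_Ioi,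
    ← ofReal_integral_eq_lintegral_ofReal (integrableOn_exp_neg_Ioi c)
      (ae_of_all _ fun _ => (Real.exp_pos _).le), integral_exp_neg_Ioi]

section PointProcess

variable {Ω : Type*} {mΩ : MeasurableSpace Ω} {P : Measure Ω}

/-- The intensity formula for a Poisson point process with enumerated points. -/
lemma IsPoissonPointProcess.tsum_measure_preimage {S : Type*} [MeasurableSpace S]
    {X : ℕ → Ω → S} {μ : Measure S} (hX : IsPoissonPointProcess (pointMeasure X) μ P)
    (hXm : ∀ i, Measurable (X i)) {A : Set S} (hA : MeasurableSet A) :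
    ∑' i, P (X i ⁻¹' A) = μ A := by
  have h1 : ∀ ω, pointMeasure X ω A = ∑' i, (X i ⁻¹' A).indicator 1 ω := fun ω => by
    rw [pointMeasure, Measure.sum_apply _ hA]
    refine tsum_congr fun i => ?_
    rw [Measure.dirac_apply' _ hA]
    rfl
  have hlaw := hX.poisson A hA
  rw [← lintegral_extPoissonMeasure (μ A), ← hlaw.map_eq,
    lintegral_map' (by fun_prop) hlaw.aemeasurable]
  simp_rw [h1]
  rw [lintegral_tsum fun i => (measurable_one.indicator (hXm i hA)).aemeasurable]
  refine tsum_congr fun i => ?_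
  rw [lintegral_indicator_one (hXm i hA)]

/-- If the points of a Poisson process of intensity `e^{-x} dx` are displaced by identically
distributed random variables `M i`, each independent of the corresponding point, then the expected
number of points displaced downwards but staying above `C` is `e^{-C} E[e^M; M ≤ 0]`. -/
lemma IsPoissonPointProcess.tsum_measure_displaced_eq [IsProbabilityMeasure P] {X : ℕ → Ω → ℝ}
    (hX : IsPoissonPointProcess (pointMeasure X) expNegMeasure P)
    (hXm : ∀ i, Measurable (X i)) {M : ℕ → Ω → ℝ} (hM : ∀ i, Measurable (M i)) {ν : Measure ℝ}
    (hMν : ∀ i, P.map (M i) = ν) (hind : ∀ i, IndepFun (X i) (M i) P) (C : ℝ) :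
    ∑' i, P {ω | C < X i ω + M i ω ∧ M i ω ≤ 0} =
      ENNReal.ofReal (Real.exp (-C)) * ∫⁻ m, expNonpos m ∂ν := by
  have hν : IsProbabilityMeasure ν :=
    hMν 0 ▸ Measure.isProbabilityMeasure_map (hM 0).aemeasurable
  have hA : MeasurableSet {p : ℝ × ℝ | C < p.1 + p.2 ∧ p.2 ≤ 0} :=
    (measurableSet_lt (f := fun _ => C) (g := fun p : ℝ × ℝ => p.1 + p.2) (by fun_prop)
      (by fun_prop)).inter
      (measurableSet_le (f := fun p : ℝ × ℝ => p.2) (g := fun _ => 0) (by fun_prop) (by fun_prop))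
  have h1 : ∀ i, P {ω | C < X i ω + M i ω ∧ M i ω ≤ 0} =
      ∫⁻ m, (Set.Iic 0).indicator (fun m => P (X i ⁻¹' Set.Ioi (C - m))) m ∂ν := by
    intro i
    have := Measure.isProbabilityMeasure_map (μ := P) (hXm i).aemeasurable
    have h2 : P {ω | C < X i ω + M i ω ∧ M i ω ≤ 0} =
        P.map (fun ω => (X i ω, M i ω)) {p : ℝ × ℝ | C < p.1 + p.2 ∧ p.2 ≤ 0} := by
      rw [Measure.map_apply ((hXm i).prodMk (hM i)) hA]
      rfl
    rw [h2, (indepFun_iff_map_prod_eq_prod_map_map (hXm i).aemeasurable (hM i).aemeasurable).1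
      (hind i), hMν i, Measure.prod_apply_symm hA]
    refine lintegral_congr fun m => ?_
    by_cases hm : m ≤ 0
    · rw [Set.indicator_of_mem (Set.mem_Iic.2 hm), ← Measure.map_apply (hXm i) measurableSet_Ioi]
      congr 1
      ext x
      simp [hm, sub_lt_iff_lt_add]
    · rw [Set.indicator_of_notMem (by simpa using hm)]
      simp [hm]
  have hmeas : ∀ i, Measurable ((Set.Iic (0 : ℝ)).indicator
      fun m => P (X i ⁻¹' Set.Ioi (C - m))) := fun i =>
    -- Lowering the threshold `C - m` enlarges the event, so the probability is monotone in `m`.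
    Measurable.indicator (Monotone.measurable fun m m' hm => measure_mono
      (Set.preimage_mono (Set.Ioi_subset_Ioi (by linarith)))) measurableSet_Iic
  simp_rw [h1]
  rw [← lintegral_tsum fun i => (hmeas i).aemeasurable,
    ← lintegral_const_mul _ measurable_expNonpos]
  refine lintegral_congr fun m => ?_
  by_cases hm : m ≤ 0
  · simp only [Set.indicator_of_mem (Set.mem_Iic.2 hm), expNonpos]
    -- With the displacement fixed at `m`, the sum over `i` is the intensity of `(C - m, ∞)`, namely
    -- `e^{m - C}`.
    rw [hX.tsum_measure_preimage hXm measurableSet_Ioi, expNegMeasure_Ioi,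
      ← ENNReal.ofReal_mul (Real.exp_pos _).le, ← Real.exp_add]
    ring_nf
  · simp [expNonpos, hm]

end PointProcess

/-! ### Summation over the windows and comparison with the stated bound. -/

lemma hasSum_geometric_exp_mul_succ {c : ℝ} (hc : 0 < c) :
    HasSum (fun j : ℕ => Real.exp (-(c * (j + 1)))) (1 / (Real.exp c - 1)) := by
  have h1 : Real.exp (-c) < 1 := Real.exp_zero ▸ Real.exp_lt_exp.2 (by linarith)
  have h2 := (hasSum_geometric_of_lt_one (Real.exp_pos (-c)).le h1).mul_left (Real.exp (-c))
  have h3 : Real.exp (-c) * (1 - Real.exp (-c))⁻¹ = 1 / (Real.exp c - 1) := by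
    have : 1 < Real.exp c := Real.one_lt_exp_iff.2 hc
    rw [Real.exp_neg]
    have : Real.exp c - 1 ≠ 0 := by linarith
    field_simp
  rw [h3] at h2
  refine h2.congr_fun fun j => ?_
  rw [← Real.exp_nat_mul, ← Real.exp_add]
  ring_nf

/-- Measuring from `b`, one spacing before the first point, starts the geometric series at exponent
`1`. Its sum `1 / (e^{h/8} - 1)` is then at most `8 / h`. -/
lemma tsum_exp_neg_div_sqrt_le {b h : ℝ} (hb : 0 < b) (hh : 0 < h) {a : ℕ → ℝ}
    (ha : ∀ j : ℕ, a j = b + (j + 1) * h) :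
    ∑' j, ENNReal.ofReal (4 * Real.exp (-(a j / 8)) / √(2 * Real.pi * a j)) ≤
      ENNReal.ofReal (8 / h * (4 * Real.exp (-(b / 8)) / √(2 * Real.pi * b))) := by
  set K : ℝ := 4 * Real.exp (-(b / 8)) / √(2 * Real.pi * b) with hK
  have hK0 : 0 ≤ K := by positivity
  have hsum := (hasSum_geometric_exp_mul_succ (c := h / 8) (by positivity)).mul_left K
  calc ∑' j, ENNReal.ofReal (4 * Real.exp (-(a j / 8)) / √(2 * Real.pi * a j))
      ≤ ∑' j : ℕ, ENNReal.ofReal (K * Real.exp (-(h / 8 * (j + 1)))) := by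
        refine ENNReal.tsum_le_tsum fun j => ENNReal.ofReal_le_ofReal ?_
        have h1 : b ≤ a j := by rw [ha]; nlinarith [Nat.cast_nonneg (α := ℝ) j]
        have h2 : Real.exp (-(a j / 8)) = Real.exp (-(b / 8)) * Real.exp (-(h / 8 * (j + 1))) := by
          rw [← Real.exp_add, ha]; ring_nf
        calc 4 * Real.exp (-(a j / 8)) / √(2 * Real.pi * a j)
            ≤ 4 * Real.exp (-(a j / 8)) / √(2 * Real.pi * b) := by gcongr
          _ = K * Real.exp (-(h / 8 * (j + 1))) := by rw [h2, hK]; ring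
    _ = ENNReal.ofReal (K * (1 / (Real.exp (h / 8) - 1))) := by
        rw [← ENNReal.ofReal_tsum_of_nonneg (fun _ => by positivity) hsum.summable, hsum.tsum_eq]
    _ ≤ ENNReal.ofReal (8 / h * K) := by
        refine ENNReal.ofReal_le_ofReal ?_
        have h1 : h / 8 ≤ Real.exp (h / 8) - 1 := by linarith [Real.add_one_le_exp (h / 8)]
        rw [mul_comm]
        refine mul_le_mul_of_nonneg_right ?_ hK0
        calc 1 / (Real.exp (h / 8) - 1) ≤ 1 / (h / 8) := by gcongr
          _ = 8 / h := by field_simp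

lemma four_mul_exp_div_sqrt_le {b : ℝ} (hb : 4 < b) :
    4 * Real.exp (-(b / 8)) / √(2 * Real.pi * b) ≤
      1 / √(2 * Real.pi) * (1 + 1 / (√b - 2)) * Real.exp (-((√b - 2) ^ 2 / 8)) := by
  set u := √b with hu
  have hbu : b = u ^ 2 := (Real.sq_sqrt (by linarith)).symm
  have hu2 : 2 < u := by rw [hu]; exact Real.lt_sqrt_of_sq_lt (by norm_num; exact hb)
  have hu2' : 0 < u - 2 := by linarith
  have h1 : Real.exp (-((u - 2) ^ 2 / 8)) = Real.exp (-(b / 8)) * Real.exp ((u - 1) / 2) := by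
    rw [← Real.exp_add, hbu]; ring_nf
  have h2 : 4 / u ≤ (1 + 1 / (u - 2)) * Real.exp ((u - 1) / 2) := by
    have h3 : (u + 1) / 2 ≤ Real.exp ((u - 1) / 2) := by
      linarith [Real.add_one_le_exp ((u - 1) / 2)]
    refine le_trans ?_ (mul_le_mul_of_nonneg_left h3 (by positivity))
    have h4 : 1 + 1 / (u - 2) = (u - 1) / (u - 2) := by field_simp; ring
    rw [h4, div_mul_div_comm, div_le_div_iff₀ (by linarith) (by linarith)]
    -- After clearing denominators this is `u³ - 9u + 16 ≥ 0`; in terms of `v = u - 2` it reads `v³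
    -- + 6v² + 3v + 6 ≥ 0`.
    nlinarith [mul_pos hu2' hu2', mul_pos (mul_pos hu2' hu2') hu2']
  rw [h1, Real.sqrt_mul (by positivity), ← hu]
  calc 4 * Real.exp (-(b / 8)) / (√(2 * Real.pi) * u)
      = 1 / √(2 * Real.pi) * Real.exp (-(b / 8)) * (4 / u) := by field_simp
    _ ≤ 1 / √(2 * Real.pi) * Real.exp (-(b / 8)) *
          ((1 + 1 / (u - 2)) * Real.exp ((u - 1) / 2)) := by gcongr
    _ = _ := by ring

lemma exists_natCast_mul_of_mem_zmultiples {h x : ℝ} (hh : 0 < h) (hx : 0 < x)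
    (hxh : x ∈ AddSubgroup.zmultiples h) : ∃ k : ℕ, x = k * h := by
  obtain ⟨z, rfl⟩ := AddSubgroup.mem_zmultiples_iff.1 hxh
  rw [zsmul_eq_mul] at hx ⊢
  have hz : 0 < z := by exact_mod_cast pos_of_mul_pos_left hx hh.le
  lift z to ℕ using hz.le
  exact ⟨z, by simp⟩

/-! ### The union bound. -/

/-- The indices `i`, `j` run over `ℕ = {0, 1, 2, …}`, so `a 0` is the first of the equidistant
points. -/
theorem mainTheorem10 {Ω : Type*} [MeasurableSpace Ω] (P : Measure Ω) [IsProbabilityMeasure P]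
    (W : ℕ → ℕ → ℝ → Ω → ℝ) (X : ℕ → ℕ → Ω → ℝ) (a : ℕ → ℝ) (h L C : ℝ)
    (hW : ∀ j i, IsTwoSidedBrownianReal (W j i) P)
    (hWindep : iIndepFun (fun (p : ℕ × ℕ) ω (t : ℝ) => W p.1 p.2 t ω) P)
    (hXmeas : ∀ j i, Measurable (X j i))
    (hX : ∀ j, IsPoissonPointProcess (pointMeasure (X j)) expNegMeasure P)
    (hXindep : iIndepFun (fun j => pointMeasure (X j)) P)
    (hXW : IndepFun (fun ω (j i : ℕ) => X j i ω) (fun ω (j i : ℕ) (t : ℝ) => W j i t ω) P)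
    (hh : 0 < h) (ha : ∀ j, a (j + 1) = a j + h) (ha0 : 4 + h < a 0)
    (ha0h : a 0 ∈ AddSubgroup.zmultiples h)
    (hL : 0 < L) (hLh : L ∈ AddSubgroup.zmultiples h) :
    P.real {ω | ∃ i j : ℕ,
        C < X j i ω + driftedLatticeSup h L (a j) (fun t => W j i t ω) ∧
        X j i ω + driftedLatticeSup h L (a j) (fun t => W j i t ω) ≤ X j i ω + W j i 0 ω} ≤
      8 * Real.exp (-C) / h *
        (Real.exp (-(√(a 0 - h) / 2))
          + 25 * L / 9 * √(2 * L / Real.pi) *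
              Real.exp (-((3 / 10 * √(a 0 - h) + 1 / 5 * √(max (a 0 - h) 25)
                - Real.log (√(max (a 0 - h) 25) / 2)) ^ 2 / (2 * L)))
          + 1 / √(2 * Real.pi) * (1 + 1 / (√(a 0 - h) - 2)) *
              Real.exp (-((√(a 0 - h) - 2) ^ 2 / 8))) := by
  obtain ⟨n, rfl⟩ := exists_natCast_mul_of_mem_zmultiples hh hL hLh
  obtain ⟨k, hk⟩ := exists_natCast_mul_of_mem_zmultiples hh (by linarith) ha0h
  have haj : ∀ j : ℕ, a j = (k + j : ℕ) * h := by
    intro j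
    induction j with
    | zero => simpa using hk
    | succ j ih => rw [ha, ih]; push_cast; ring
  lift h to ℝ≥0 using hh.le
  set b : ℝ := a 0 - h with hb
  have hb4 : 4 < b := by linarith
  have hk0 : k ≠ 0 := by
    rintro rfl
    simp at hk
    linarith
  have hh0 : (0 : ℝ≥0) < h := hh
  let M (j i : ℕ) (ω : Ω) : ℝ := latticeMax h ((k + j : ℕ) * h) n (fun t => W j i (t : ℝ) ω)
  have hMm : ∀ j i, Measurable (M j i) := fun j i => (measurable_latticeMax _ _ _).comp
    (measurable_pi_lambda _ fun t => (hW j i).measurable t)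
  have hsup : ∀ j i ω, driftedLatticeSup h (n * h) (a j) (fun t => W j i t ω) = M j i ω :=
    fun j i ω => by rw [haj]; exact driftedLatticeSup_eq_latticeMax h hh0 (k + j) n _
  have hind : ∀ j i, IndepFun (X j i) (M j i) P := by
    intro j i
    have hφ : Measurable (fun x : ℕ → ℕ → ℝ => x j i) := by fun_prop
    have hrestrict : Measurable (fun (w : ℕ → ℕ → ℝ → ℝ) (t : ℝ≥0) => w j i (t : ℝ)) := by
      fun_prop
    exact hXW.comp hφ ((measurable_latticeMax h ((k + j : ℕ) * h) n).comp hrestrict)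
  have hlevel : ∀ j, ∑' i, P {ω | C < X j i ω + M j i ω ∧ M j i ω ≤ 0} ≤
      ENNReal.ofReal (Real.exp (-C)) *
        ENNReal.ofReal (4 * Real.exp (-(a j / 8)) / √(2 * Real.pi * a j)) := by
    intro j
    rw [(hX j).tsum_measure_displaced_eq (hXmeas j) (hMm j) (ν := P.map (M j 0))
      (fun i => map_latticeMax_eq (hW j i).forward.toIsPreBrownianReal
        (hW j 0).forward.toIsPreBrownianReal (fun t => (hW j i).measurable t)
        (fun t => (hW j 0).measurable t) _ _ _) (hind j) C,
      lintegral_map measurable_expNonpos (hMm j 0)]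
    gcongr
    have hne : ((k + j : ℕ) * h : ℝ≥0) ≠ 0 :=
      mul_ne_zero (Nat.cast_ne_zero.2 (by omega)) hh0.ne'
    have := lintegral_expNonpos_latticeMax_le (hW j 0).forward.toIsPreBrownianReal
      (fun t => (hW j 0).measurable t) h hne n
    have hcast : (((k + j : ℕ) * h : ℝ≥0) : ℝ) = a j := by rw [haj]; push_cast; rfl
    rwa [hcast] at this
  have hsub : P {ω | ∃ i j : ℕ,
        C < X j i ω + driftedLatticeSup h (n * h) (a j) (fun t => W j i t ω) ∧
        X j i ω + driftedLatticeSup h (n * h) (a j) (fun t => W j i t ω) ≤ X j i ω + W j i 0 ω} ≤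
      P (⋃ j, ⋃ i, {ω | C < X j i ω + M j i ω ∧ M j i ω ≤ 0}) := by
    have hzero : ∀ᵐ ω ∂P, ∀ j i, W j i 0 ω = 0 := by
      refine ae_all_iff.2 fun j => ae_all_iff.2 fun i => ?_
      simpa using (hW j i).forward.toIsPreBrownianReal.eval_zero_ae_eq_zero
    refine measure_mono_ae ?_
    filter_upwards [hzero] with ω hω
    rintro ⟨i, j, h1, h2⟩
    rw [hsup] at h1 h2
    refine Set.mem_iUnion₂.2 ⟨j, i, h1, ?_⟩
    rw [hω] at h2
    linarith
  have hmain : P {ω | ∃ i j : ℕ,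
        C < X j i ω + driftedLatticeSup h (n * h) (a j) (fun t => W j i t ω) ∧
        X j i ω + driftedLatticeSup h (n * h) (a j) (fun t => W j i t ω) ≤ X j i ω + W j i 0 ω} ≤
      ENNReal.ofReal (Real.exp (-C) *
        (8 / h * (4 * Real.exp (-(b / 8)) / √(2 * Real.pi * b)))) := by
    calc _ ≤ P (⋃ j, ⋃ i, {ω | C < X j i ω + M j i ω ∧ M j i ω ≤ 0}) := hsub
      _ ≤ ∑' j, ∑' i, P {ω | C < X j i ω + M j i ω ∧ M j i ω ≤ 0} :=
          (measure_iUnion_le _).trans (ENNReal.tsum_le_tsum fun j => measure_iUnion_le _)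
      _ ≤ ∑' j, ENNReal.ofReal (Real.exp (-C)) *
            ENNReal.ofReal (4 * Real.exp (-(a j / 8)) / √(2 * Real.pi * a j)) :=
          ENNReal.tsum_le_tsum hlevel
      _ ≤ _ := by
          rw [ENNReal.tsum_mul_left, ENNReal.ofReal_mul (Real.exp_pos _).le]
          gcongr
          refine tsum_exp_neg_div_sqrt_le (by linarith) hh fun j => ?_
          rw [hb, haj, haj]
          push_cast
          ring
  have hu : 0 < √b - 2 := by
    have : 2 < √b := Real.lt_sqrt_of_sq_lt (by norm_num; exact hb4)
    linarith
  refine (ENNReal.toReal_le_of_le_ofReal (by positivity) hmain).trans ?_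
  calc Real.exp (-C) * (8 / h * (4 * Real.exp (-(b / 8)) / √(2 * Real.pi * b)))
      = 8 * Real.exp (-C) / h * (4 * Real.exp (-(b / 8)) / √(2 * Real.pi * b)) := by ring
    _ ≤ _ := by
        refine mul_le_mul_of_nonneg_left ?_ (by positivity)
        -- The first two terms of the claimed bound are nonnegative and serve only as slack.
        exact (four_mul_exp_div_sqrt_le hb4).trans (le_add_of_nonneg_left (by positivity))
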